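/- Let $n\in\mathbb N$ and let $\Omega\subseteq\mathbb R^n$ be nonempty, open and bounded. For $u\in L^1(\mathbb R^n)$ let $$|Du|(\mathbb R^n)=\sup\Big\{\int_{\mathbb R^n}u\,\operatorname{div}\varphi\,dx\;;\;\varphi\in C_c^\infty(\mathbb R^n,\mathbb R^n),\ |\varphi|\le 1\Big\}\in[0,\infty]$$ denote its total variation, and let $BV(\Omega)$ denote the space of all $u\in L^1(\mathbb R^n)$ with $|Du|(\mathbb R^n)<\infty$ and $u=0$ a.e. on $\mathbb R^n\setminus\Omega$. Let $\Sigma=\{te_1\;;\;t\ge0\}\cup\{te_2\;;\;t\ge0\}\subset\mathbb R^2$, and let $BV(\Omega,\Sigma)$ be the set of all $u=(u^1,u^2)$ with $u^1,u^2\in BV(\Omega)$ and $u(x)\in\Sigma$ for a.e. $x\in\Omega$. Write $\|\cdot\|_1$ for the norm of $L^1(\Omega)$, and $v^+=\max(v,0)$, $v^-=\max(-v,0)$. Define, as infima in $[0,\infty]$, $$\Lambda_2=\inf\big\{|Du^1|(\mathbb R^n)+|Du^2|(\mathbb R^n)\;;\;u\in BV(\Omega,\Sigma),\ \|u^1\|_1=\|u^2\|_1=1\big\},$$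 $$M_2=\inf\big\{|Dv|(\mathbb R^n)\;;\;v\in BV(\Omega),\ \|v^+\|_1=\|v^-\|_1=1\big\}.$$ Then $\Lambda_2=M_2$. Moreover, if $u=(u^1,u^2)$ is a minimizer of the problem defining $\Lambda_2$, then $v=u^1-u^2$ is a minimizer of the problem defining $M_2$; and if $v$ is a minimizer of the problem defining $M_2$, then $(v^+,v^-)$ is a minimizer of the problem defining $\Lambda_2$. -/

import Mathlib

open MeasureTheory
open scoped ENNReal ContDiff

/-- The divergence `∑ i, ∂ᵢ φᵢ` of a vector field on `ℝⁿ`. -/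
noncomputable def divergence {n : ℕ} (φ : EuclideanSpace ℝ (Fin n) → EuclideanSpace ℝ (Fin n))
    (x : EuclideanSpace ℝ (Fin n)) : ℝ :=
  ∑ i, (fderiv ℝ φ x (EuclideanSpace.single i 1)) i

/-- Test vector fields: `φ ∈ C_c^∞(ℝⁿ, ℝⁿ)` with `|φ| ≤ 1` (Euclidean norm). -/
structure IsTestField {n : ℕ} (φ : EuclideanSpace ℝ (Fin n) → EuclideanSpace ℝ (Fin n)) :
    Prop where
  contDiff : ContDiff ℝ ∞ φ
  hasCompactSupport : HasCompactSupport φ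
  norm_le_one : ∀ x, ‖φ x‖ ≤ 1

/-- The total variation `|Du|(ℝⁿ)`, that is the supremum of `∫ u div φ` over all test vector
fields, as an element of `[0, ∞]`. It is used for integrable `u`. (Since `-φ` is a test field
whenever `φ` is, replacing negative values of the integral by `0` does not change the supremum.) -/
noncomputable def totalVariation {n : ℕ} (u : EuclideanSpace ℝ (Fin n) → ℝ) : ℝ≥0∞ :=
  ⨆ (φ : EuclideanSpace ℝ (Fin n) → EuclideanSpace ℝ (Fin n)) (_ : IsTestField φ),
    ENNReal.ofReal (∫ x, u x * divergence φ x)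

/-- The space `BV(Ω)`, read as `{u ∈ BV(ℝⁿ) ; u = 0 a.e. on ℝⁿ \ Ω}`. -/
structure MemBV {n : ℕ} (Ω : Set (EuclideanSpace ℝ (Fin n)))
    (u : EuclideanSpace ℝ (Fin n) → ℝ) : Prop where
  integrable : Integrable u
  totalVariation_lt_top : totalVariation u < ⊤
  ae_eq_zero : ∀ᵐ x, x ∉ Ω → u x = 0

/-- The skeleton `Σ = ⋃ i, {t eᵢ ; t ≥ 0}` of the positive coordinate axes of `ℝᴺ`. -/
def skeleton (N : ℕ) : Set (EuclideanSpace ℝ (Fin N)) :=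
  ⋃ i : Fin N, {y | ∃ t : ℝ, 0 ≤ t ∧ y = t • EuclideanSpace.single i (1 : ℝ)}

/-- `BV(Ω, Σ)`: the functions with values in `ℝᴺ`, all components in `BV(Ω)`, that take values
in the skeleton almost everywhere in `Ω`. -/
structure MemBVSkeleton {n : ℕ} (N : ℕ) (Ω : Set (EuclideanSpace ℝ (Fin n)))
    (u : EuclideanSpace ℝ (Fin n) → EuclideanSpace ℝ (Fin N)) : Prop where
  memBV : ∀ i, MemBV Ω (fun x => u x i)
  ae_mem : ∀ᵐ x ∂(volume.restrict Ω), u x ∈ skeleton N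

/-- The functional `𝓔(u) = ∑ i, |Duⁱ|(ℝⁿ)`. -/
noncomputable def clusterEnergy {n N : ℕ}
    (u : EuclideanSpace ℝ (Fin n) → EuclideanSpace ℝ (Fin N)) : ℝ≥0∞ :=
  ∑ i, totalVariation (fun x => u x i)

/-- The competitors for `Λ_N`: those `u ∈ BV(Ω, Σ)` with `‖uⁱ‖₁ = 1` for every `i`. -/
def clusterAdmissible {n : ℕ} (N : ℕ) (Ω : Set (EuclideanSpace ℝ (Fin n))) :
    Set (EuclideanSpace ℝ (Fin n) → EuclideanSpace ℝ (Fin N)) :=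
  {u | MemBVSkeleton N Ω u ∧ ∀ i, eLpNorm (fun x => u x i) 1 (volume.restrict Ω) = 1}

/-- The constant `Λ_N`. -/
noncomputable def clusterInf {n : ℕ} (N : ℕ) (Ω : Set (EuclideanSpace ℝ (Fin n))) : ℝ≥0∞ :=
  ⨅ u ∈ clusterAdmissible N Ω, clusterEnergy u

/-- `u` is a minimizer of the problem defining `Λ_N`. -/
def IsClusterMinimizer {n : ℕ} (N : ℕ) (Ω : Set (EuclideanSpace ℝ (Fin n)))
    (u : EuclideanSpace ℝ (Fin n) → EuclideanSpace ℝ (Fin N)) : Prop :=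
  u ∈ clusterAdmissible N Ω ∧ clusterEnergy u = clusterInf N Ω

/-- The competitors for `M₂`: those `v ∈ BV(Ω)` with `‖v⁺‖₁ = ‖v⁻‖₁ = 1`. -/
def signedAdmissible {n : ℕ} (Ω : Set (EuclideanSpace ℝ (Fin n))) :
    Set (EuclideanSpace ℝ (Fin n) → ℝ) :=
  {v | MemBV Ω v ∧ eLpNorm (fun x => (v x)⁺) 1 (volume.restrict Ω) = 1 ∧
    eLpNorm (fun x => (v x)⁻) 1 (volume.restrict Ω) = 1}

/-- The constant `M₂`. -/
noncomputable def signedInf {n : ℕ} (Ω : Set (EuclideanSpace ℝ (Fin n))) : ℝ≥0∞ :=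
  ⨅ v ∈ signedAdmissible Ω, totalVariation v

/-- `v` is a minimizer of the problem defining `M₂`. -/
def IsSignedMinimizer {n : ℕ} (Ω : Set (EuclideanSpace ℝ (Fin n)))
    (v : EuclideanSpace ℝ (Fin n) → ℝ) : Prop :=
  v ∈ signedAdmissible Ω ∧ totalVariation v = signedInf Ω

/-!
The two problems are exchanged by `u ↦ u¹ - u²` and `v ↦ (v⁺, v⁻)`. A function with values in the
skeleton has components that are nonnegative with disjoint supports, so they are the positive and
negative parts of their difference. Everything therefore rests on the identity
`|Dv⁺|(ℝⁿ) + |Dv⁻|(ℝⁿ) = |Dv|(ℝⁿ)` for integrable `v` (`totalVariation_posPart_add_negPart`), which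
makes both maps preserve admissibility and energy.

The inequality `≥` is subadditivity. For `≤`, let `φ`, `ψ` be test fields. If `w` is smooth and
`H` is a smooth approximation of the positive part with `h = H' ∈ [0, 1]`, then
`h(w) φ - (1 - h(w)) ψ` is again a test field, being pointwise a convex combination of `φ` and
`-ψ`, and the integral of `w` against its divergence is `∫ H(w) div φ + ∫ (H(w) - w) div ψ`
(`integral_mul_divergence_comp_smul_sub`). As `H` tends to the positive part, this tends to
`∫ w⁺ div φ + ∫ w⁻ div ψ`, which is thus at most `|Dw|(ℝⁿ)`. For general `v` this is applied to its
mollifications: as averages of translates of `v` they have no larger total variation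
(`integral_mollify_mul_divergence_le`), and they approximate `v` in `L¹` with weight
`|div φ| + |div ψ|` (`exists_mollify_integral_abs_sub_mul_le`).
-/

open Filter Topology

section

variable {n : ℕ}

/-! ### The divergence -/

lemma continuous_divergence {φ : EuclideanSpace ℝ (Fin n) → EuclideanSpace ℝ (Fin n)}
    (hφ : ContDiff ℝ ∞ φ) : Continuous (divergence φ) := by
  unfold divergence
  have := hφ.continuous_fderiv (by simp)
  fun_prop

lemma HasCompactSupport.divergence
    {φ : EuclideanSpace ℝ (Fin n) → EuclideanSpace ℝ (Fin n)}
    (hφ : HasCompactSupport φ) : HasCompactSupport (divergence φ) := by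
  refine (hφ.fderiv ℝ).mono fun x hx => ?_
  contrapose! hx
  simp only [Function.notMem_support] at hx ⊢
  simp [_root_.divergence, hx]

lemma divergence_smul {a : EuclideanSpace ℝ (Fin n) → ℝ}
    {Y : EuclideanSpace ℝ (Fin n) → EuclideanSpace ℝ (Fin n)} {x : EuclideanSpace ℝ (Fin n)}
    (ha : DifferentiableAt ℝ a x) (hY : DifferentiableAt ℝ Y x) :
    divergence (fun y => a y • Y y) x = a x * divergence Y x + fderiv ℝ a x (Y x) := by
  have h : fderiv ℝ a x (Y x) = ∑ i, fderiv ℝ a x (EuclideanSpace.single i 1) * Y x i := by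
    conv_lhs => rw [← (EuclideanSpace.basisFun (Fin n) ℝ).sum_repr (Y x)]
    simp [mul_comm]
  rw [h]
  simp only [divergence]
  rw [fderiv_fun_smul ha hY]
  simp [Finset.sum_add_distrib, Finset.mul_sum]

lemma divergence_sub {φ ψ : EuclideanSpace ℝ (Fin n) → EuclideanSpace ℝ (Fin n)}
    {x : EuclideanSpace ℝ (Fin n)} (hφ : DifferentiableAt ℝ φ x) (hψ : DifferentiableAt ℝ ψ x) :
    divergence (fun y => φ y - ψ y) x = divergence φ x - divergence ψ x := by
  simp [divergence, fderiv_fun_sub hφ hψ, Finset.sum_sub_distrib]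

lemma divergence_add {φ ψ : EuclideanSpace ℝ (Fin n) → EuclideanSpace ℝ (Fin n)}
    {x : EuclideanSpace ℝ (Fin n)} (hφ : DifferentiableAt ℝ φ x) (hψ : DifferentiableAt ℝ ψ x) :
    divergence (fun y => φ y + ψ y) x = divergence φ x + divergence ψ x := by
  simp [divergence, fderiv_fun_add hφ hψ, Finset.sum_add_distrib]

lemma divergence_neg (φ : EuclideanSpace ℝ (Fin n) → EuclideanSpace ℝ (Fin n))
    (x : EuclideanSpace ℝ (Fin n)) : divergence (fun y => -φ y) x = -divergence φ x := by
  simp [divergence, fderiv_fun_neg]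

lemma divergence_comp_add_right (φ : EuclideanSpace ℝ (Fin n) → EuclideanSpace ℝ (Fin n))
    (t x : EuclideanSpace ℝ (Fin n)) :
    divergence (fun y => φ (y + t)) x = divergence φ (x + t) := by
  simp [divergence, fderiv_comp_add_right]

lemma integral_divergence_eq_zero
    {X : EuclideanSpace ℝ (Fin n) → EuclideanSpace ℝ (Fin n)} (hX : ContDiff ℝ ∞ X)
    (hc : HasCompactSupport X) : ∫ x, divergence X x = 0 := by
  have hcont := hX.continuous_fderiv (by simp)
  have hint (i : Fin n) :
      Integrable (fun x => (fderiv ℝ X x (EuclideanSpace.single i 1)) i) := by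
    refine Continuous.integrable_of_hasCompactSupport (by fun_prop) ?_
    refine (hc.fderiv ℝ).mono fun x hx => ?_
    contrapose! hx
    simp only [Function.notMem_support] at hx ⊢
    simp [hx]
  unfold divergence
  rw [integral_finsetSum _ fun i _ => hint i]
  refine Finset.sum_eq_zero fun i _ => ?_
  have hd : Differentiable ℝ X := hX.differentiable (by simp)
  have hfd (x : EuclideanSpace ℝ (Fin n)) : fderiv ℝ (fun y => X y i) x =
      (EuclideanSpace.proj i).comp (fderiv ℝ X x) :=
    ((EuclideanSpace.proj (𝕜 := ℝ) i).hasFDerivAt.comp x (hd x).hasFDerivAt).fderiv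
  have hXi : Integrable (fun x => X x i) := by
    refine Continuous.integrable_of_hasCompactSupport ?_ ?_
    · have := hX.continuous
      fun_prop
    · refine hc.mono fun x hx => ?_
      contrapose! hx
      simp only [Function.notMem_support] at hx ⊢
      simp [hx]
  have key := integral_mul_fderiv_eq_neg_fderiv_mul_of_integrable (μ := volume) (𝕜 := ℝ)
    (f := fun _ : EuclideanSpace ℝ (Fin n) => (1 : ℝ)) (g := fun x => X x i)
    (v := EuclideanSpace.single i 1) (by simp) (by simpa [hfd] using hint i)
    (by simpa using hXi) (fun x _ => by fun_prop) (fun x _ => by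
      have := hd x
      fun_prop)
  simpa [hfd] using key

/-! ### Test fields and the total variation -/

namespace IsTestField

variable {φ ψ : EuclideanSpace ℝ (Fin n) → EuclideanSpace ℝ (Fin n)}

lemma differentiable (hφ : IsTestField φ) : Differentiable ℝ φ :=
  hφ.contDiff.differentiable (by simp)

lemma zero : IsTestField (fun _ : EuclideanSpace ℝ (Fin n) => (0 : EuclideanSpace ℝ (Fin n))) :=
  ⟨contDiff_const, HasCompactSupport.zero, by simp⟩

lemma neg (hφ : IsTestField φ) : IsTestField (fun x => -φ x) :=
  ⟨hφ.contDiff.neg, hφ.hasCompactSupport.neg, by simpa using hφ.norm_le_one⟩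

lemma comp_add_right (hφ : IsTestField φ) (t : EuclideanSpace ℝ (Fin n)) :
    IsTestField (fun x => φ (x + t)) :=
  ⟨hφ.contDiff.comp (contDiff_id.add contDiff_const),
    hφ.hasCompactSupport.comp_homeomorph (Homeomorph.addRight t), fun _ => hφ.norm_le_one _⟩

/-- A convex combination, with smooth weights, of the test fields `φ` and `-ψ`. -/
lemma smul_sub (hφ : IsTestField φ) (hψ : IsTestField ψ) {a : EuclideanSpace ℝ (Fin n) → ℝ}
    (ha : ContDiff ℝ ∞ a) (h0 : ∀ x, 0 ≤ a x) (h1 : ∀ x, a x ≤ 1) :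
    IsTestField (fun x => a x • (φ x + ψ x) - ψ x) := by
  refine ⟨(ha.smul (hφ.contDiff.add hψ.contDiff)).sub hψ.contDiff, ?_, fun x => ?_⟩
  · exact ((hφ.hasCompactSupport.add hψ.hasCompactSupport).smul_left (f := a)).sub
      hψ.hasCompactSupport
  · have : a x • (φ x + ψ x) - ψ x = a x • φ x - (1 - a x) • ψ x := by module
    rw [this]
    refine (norm_sub_le _ _).trans ?_
    rw [norm_smul, norm_smul, Real.norm_of_nonneg (h0 x), Real.norm_of_nonneg (by linarith [h1 x])]
    nlinarith [hφ.norm_le_one x, hψ.norm_le_one x, h0 x, h1 x]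

lemma continuous_divergence (hφ : IsTestField φ) : Continuous (divergence φ) :=
  _root_.continuous_divergence hφ.contDiff

lemma integrable_mul_divergence {u : EuclideanSpace ℝ (Fin n) → ℝ} (hu : Integrable u)
    (hφ : IsTestField φ) : Integrable (fun x => u x * divergence φ x) := by
  obtain ⟨C, hC⟩ := hφ.continuous_divergence.bounded_above_of_compact_support
    hφ.hasCompactSupport.divergence
  exact hu.mul_bdd (c := C) hφ.continuous_divergence.aestronglyMeasurable (ae_of_all _ hC)

lemma integrable_continuous_mul_divergence {w : EuclideanSpace ℝ (Fin n) → ℝ} (hw : Continuous w)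
    (hφ : IsTestField φ) : Integrable (fun x => w x * divergence φ x) :=
  (hw.mul hφ.continuous_divergence).integrable_of_hasCompactSupport
    hφ.hasCompactSupport.divergence.mul_left

lemma ofReal_integral_le_totalVariation (u : EuclideanSpace ℝ (Fin n) → ℝ)
    (hφ : IsTestField φ) :
    ENNReal.ofReal (∫ x, u x * divergence φ x) ≤ totalVariation u :=
  le_iSup₂_of_le φ hφ le_rfl

end IsTestField

lemma totalVariation_congr_ae {u v : EuclideanSpace ℝ (Fin n) → ℝ} (h : u =ᵐ[volume] v) :
    totalVariation u = totalVariation v := by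
  unfold totalVariation
  refine iSup_congr fun φ => iSup_congr fun _ => ?_
  congr 1
  refine integral_congr_ae ?_
  filter_upwards [h] with x hx
  rw [hx]

/-- The total variation is subadditive; the sign is absorbed by replacing `φ` with `-φ`. -/
lemma totalVariation_sub_le {u v : EuclideanSpace ℝ (Fin n) → ℝ} (hu : Integrable u)
    (hv : Integrable v) :
    totalVariation (fun x => u x - v x) ≤ totalVariation u + totalVariation v := by
  refine iSup₂_le fun φ hφ => ?_
  have h : ∫ x, (u x - v x) * divergence φ x =
      (∫ x, u x * divergence φ x) + ∫ x, v x * divergence (fun y => -φ y) x := by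
    rw [← integral_add (hφ.integrable_mul_divergence hu) (hφ.neg.integrable_mul_divergence hv)]
    refine integral_congr_ae (ae_of_all _ fun x => ?_)
    simp only [divergence_neg]
    ring
  rw [h]
  exact ENNReal.ofReal_add_le.trans (add_le_add (hφ.ofReal_integral_le_totalVariation u)
    (hφ.neg.ofReal_integral_le_totalVariation v))

/-- To bound `|Du| + |Dv|` it suffices to bound the sums of the integrals, whatever their signs,
because `0` is a test field. -/
lemma totalVariation_add_le_of_forall {u v : EuclideanSpace ℝ (Fin n) → ℝ} {T : ℝ}
    (h : ∀ φ ψ : EuclideanSpace ℝ (Fin n) → EuclideanSpace ℝ (Fin n),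
      IsTestField φ → IsTestField ψ →
      (∫ x, u x * divergence φ x) + ∫ x, v x * divergence ψ x ≤ T) :
    totalVariation u + totalVariation v ≤ ENNReal.ofReal T := by
  have hzero (w : EuclideanSpace ℝ (Fin n) → ℝ) :
      ∫ x, w x * divergence (fun _ : EuclideanSpace ℝ (Fin n) =>
        (0 : EuclideanSpace ℝ (Fin n))) x = 0 := by
    simp [divergence]
  unfold totalVariation
  refine ENNReal.biSup_add_biSup_le' ⟨_, IsTestField.zero⟩ ⟨_, IsTestField.zero⟩
    fun φ hφ ψ hψ => ?_
  rcases le_total 0 (∫ x, u x * divergence φ x) with h1 | h1 <;>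
  rcases le_total 0 (∫ x, v x * divergence ψ x) with h2 | h2
  · rw [← ENNReal.ofReal_add h1 h2]
    exact ENNReal.ofReal_le_ofReal (h φ ψ hφ hψ)
  · rw [ENNReal.ofReal_of_nonpos h2, add_zero]
    exact ENNReal.ofReal_le_ofReal (by simpa [hzero] using h φ _ hφ .zero)
  · rw [ENNReal.ofReal_of_nonpos h1, zero_add]
    exact ENNReal.ofReal_le_ofReal (by simpa [hzero] using h _ ψ .zero hψ)
  · rw [ENNReal.ofReal_of_nonpos h1, ENNReal.ofReal_of_nonpos h2, add_zero]
    exact zero_le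

/-! ### Splitting a smooth function -/

/-- The two pairings `w div (h(w)(φ + ψ) - ψ)` and `H(w) div φ + (H(w) - w) div ψ` differ by the
divergence of `(w h(w) - H(w))(φ + ψ)`, since `d(w h(w) - H(w)) = w d(h(w))`. -/
lemma mul_divergence_comp_smul_sub
    {w : EuclideanSpace ℝ (Fin n) → ℝ} (hw : Differentiable ℝ w)
    {φ ψ : EuclideanSpace ℝ (Fin n) → EuclideanSpace ℝ (Fin n)}
    (hφ : IsTestField φ) (hψ : IsTestField ψ) {H h : ℝ → ℝ}
    (hhw : Differentiable ℝ fun x => h (w x)) (hHw : Differentiable ℝ fun x => H (w x))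
    (hd : ∀ t, HasDerivAt H (h t) t) (x : EuclideanSpace ℝ (Fin n)) :
    w x * divergence (fun y => h (w y) • (φ y + ψ y) - ψ y) x =
      divergence (fun y => (w y * h (w y) - H (w y)) • (φ y + ψ y)) x +
        (H (w x) * divergence φ x + (H (w x) - w x) * divergence ψ x) := by
  have hY : DifferentiableAt ℝ (fun y => φ y + ψ y) x :=
    (hφ.differentiable x).fun_add (hψ.differentiable x)
  have hHf : fderiv ℝ (fun y => H (w y)) x = h (w x) • fderiv ℝ w x :=
    ((hd (w x)).comp_hasFDerivAt x (hw x).hasFDerivAt).fderiv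
  have hwh := (hw x).fun_mul (hhw x)
  rw [divergence_sub ((hhw x).fun_smul hY) (hψ.differentiable x),
    divergence_smul (hhw x) hY, divergence_smul (hwh.fun_sub (hHw x)) hY,
    divergence_add (hφ.differentiable x) (hψ.differentiable x),
    fderiv_fun_sub hwh (hHw x), fderiv_fun_mul (hw x) (hhw x), hHf]
  simp only [sub_apply, add_apply,
    smul_apply, smul_eq_mul]
  ring

/-- Testing `w` with the field `h(w)(φ + ψ) - ψ`, where `h = H'`, is the same as testing `H(w)`
with `φ` and `H(w) - w` with `ψ`. -/
lemma integral_mul_divergence_comp_smul_sub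
    {w : EuclideanSpace ℝ (Fin n) → ℝ} (hw : ContDiff ℝ ∞ w)
    {φ ψ : EuclideanSpace ℝ (Fin n) → EuclideanSpace ℝ (Fin n)}
    (hφ : IsTestField φ) (hψ : IsTestField ψ) {H h : ℝ → ℝ}
    (hH : ContDiff ℝ ∞ H) (hh : ContDiff ℝ ∞ h) (hd : ∀ t, HasDerivAt H (h t) t) :
    ∫ x, w x * divergence (fun y => h (w y) • (φ y + ψ y) - ψ y) x =
      (∫ x, H (w x) * divergence φ x) + ∫ x, (H (w x) - w x) * divergence ψ x := by
  have hY : ContDiff ℝ ∞ (fun x => φ x + ψ x) := hφ.contDiff.add hψ.contDiff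
  have hhw : ContDiff ℝ ∞ (fun x => h (w x)) := hh.comp hw
  have hHw : ContDiff ℝ ∞ (fun x => H (w x)) := hH.comp hw
  have hK : ContDiff ℝ ∞ (fun x => w x * h (w x) - H (w x)) := (hw.mul hhw).sub hHw
  have hwd := hw.differentiable (by simp)
  have hhwd := hhw.differentiable (by simp)
  have hHwd := hHw.differentiable (by simp)
  have i1 := IsTestField.integrable_continuous_mul_divergence hHw.continuous hφ
  have i2 := IsTestField.integrable_continuous_mul_divergence (hHw.sub hw).continuous hψ
  have hKY : ContDiff ℝ ∞ (fun x => (w x * h (w x) - H (w x)) • (φ x + ψ x)) := hK.smul hY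
  have hKYc : HasCompactSupport (fun x => (w x * h (w x) - H (w x)) • (φ x + ψ x)) :=
    (hφ.hasCompactSupport.add hψ.hasCompactSupport).smul_left
      (f := fun x => w x * h (w x) - H (w x))
  have iK := (continuous_divergence hKY).integrable_of_hasCompactSupport hKYc.divergence
    (μ := volume)
  calc _ = ∫ x, (divergence (fun y => (w y * h (w y) - H (w y)) • (φ y + ψ y)) x +
        (H (w x) * divergence φ x + (H (w x) - w x) * divergence ψ x)) :=
        integral_congr_ae (ae_of_all _ (mul_divergence_comp_smul_sub hwd hφ hψ hhwd hHwd hd))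
    _ = _ := integral_add iK (i1.add i2)
    _ = ∫ x, (H (w x) * divergence φ x + (H (w x) - w x) * divergence ψ x) := by
        rw [integral_divergence_eq_zero hKY hKYc, zero_add]
    _ = _ := integral_add i1 i2

/-- The functions `t ↦ (t + √(t² + δ²)) / 2` are smooth, have derivative in `[0, 1]`, and are
within `δ / 2` of the positive part. -/
lemma exists_smooth_approx_posPart {δ : ℝ} (hδ : 0 < δ) :
    ∃ H h : ℝ → ℝ, ContDiff ℝ ∞ H ∧ ContDiff ℝ ∞ h ∧ (∀ t, HasDerivAt H (h t) t) ∧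
      (∀ t, 0 ≤ h t) ∧ (∀ t, h t ≤ 1) ∧ ∀ t, |H t - t⁺| ≤ δ := by
  have hpos (t : ℝ) : 0 < t ^ 2 + δ ^ 2 := by positivity
  have hs : ContDiff ℝ ∞ (fun t : ℝ => √(t ^ 2 + δ ^ 2)) :=
    ContDiff.sqrt (by fun_prop) fun t => (hpos t).ne'
  have hle (t : ℝ) : |t| ≤ √(t ^ 2 + δ ^ 2) := Real.abs_le_sqrt (by nlinarith)
  have hs0 (t : ℝ) : 0 < √(t ^ 2 + δ ^ 2) := Real.sqrt_pos.2 (hpos t)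
  refine ⟨fun t => (t + √(t ^ 2 + δ ^ 2)) / 2, fun t => (1 + t / √(t ^ 2 + δ ^ 2)) / 2,
    (contDiff_id.add hs).div_const 2,
    (contDiff_const.add (contDiff_id.div hs fun t => (hs0 t).ne')).div_const 2,
    fun t => ?_, fun t => ?_, fun t => ?_, fun t => ?_⟩
  · have h1 : HasDerivAt (fun t : ℝ => t ^ 2 + δ ^ 2) (2 * t) t := by
      simpa using (hasDerivAt_pow 2 t).add_const (δ ^ 2)
    have h2 := ((hasDerivAt_id t).add (h1.sqrt (hpos t).ne')).div_const 2
    refine h2.congr_deriv ?_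
    rw [mul_div_mul_left _ _ two_ne_zero]
  · have := neg_le_of_abs_le (hle t)
    have : -1 ≤ t / √(t ^ 2 + δ ^ 2) := by rw [le_div_iff₀ (hs0 t)]; linarith
    linarith
  · have := le_of_abs_le (hle t)
    have : t / √(t ^ 2 + δ ^ 2) ≤ 1 := by rw [div_le_iff₀ (hs0 t)]; linarith
    linarith
  · have h3 : √(t ^ 2 + δ ^ 2) ≤ |t| + δ := by
      refine Real.sqrt_le_iff.2 ⟨by positivity, ?_⟩
      nlinarith [sq_abs t, abs_nonneg t]
    have h4 : t⁺ = (t + |t|) / 2 := by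
      have e1 := posPart_add_negPart t
      have e2 := posPart_sub_negPart t
      linarith
    rw [h4, abs_le]
    constructor <;> linarith [hle t]

/-- For smooth `w` the positive and negative parts can be tested separately, at no cost compared
with testing `w` itself. -/
lemma integral_posPart_add_integral_negPart_le_of_contDiff
    {w : EuclideanSpace ℝ (Fin n) → ℝ} (hw : ContDiff ℝ ∞ w) {T : ℝ}
    (hT : ∀ X : EuclideanSpace ℝ (Fin n) → EuclideanSpace ℝ (Fin n), IsTestField X →
      ∫ x, w x * divergence X x ≤ T)
    {φ ψ : EuclideanSpace ℝ (Fin n) → EuclideanSpace ℝ (Fin n)}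
    (hφ : IsTestField φ) (hψ : IsTestField ψ) :
    (∫ x, (w x)⁺ * divergence φ x) + ∫ x, (w x)⁻ * divergence ψ x ≤ T := by
  have hwp : Continuous fun x => (w x)⁺ := hw.continuous.sup continuous_const
  have hwn : Continuous fun x => (w x)⁻ := hw.continuous.neg.sup continuous_const
  have iφ : Integrable (fun x => |divergence φ x|) :=
    (hφ.continuous_divergence.integrable_of_hasCompactSupport
      hφ.hasCompactSupport.divergence).abs
  have iψ : Integrable (fun x => |divergence ψ x|) :=
    (hψ.continuous_divergence.integrable_of_hasCompactSupport
      hψ.hasCompactSupport.divergence).abs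
  have i1 := IsTestField.integrable_continuous_mul_divergence hwp hφ
  have i2 := IsTestField.integrable_continuous_mul_divergence hwn hψ
  have hδ (δ : ℝ) (hδ : 0 < δ) :
      (∫ x, (w x)⁺ * divergence φ x) + ∫ x, (w x)⁻ * divergence ψ x ≤
        T + δ * ((∫ x, |divergence φ x|) + ∫ x, |divergence ψ x|) := by
    obtain ⟨H, h, hH, hh, hd, h0, h1, hc⟩ := exists_smooth_approx_posPart hδ
    have key := hT _ (hφ.smul_sub hψ (hh.comp hw) (fun x => h0 _) (fun x => h1 _))
    simp only [Function.comp_def] at key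
    rw [integral_mul_divergence_comp_smul_sub hw hφ hψ hH hh hd] at key
    have hHw : ContDiff ℝ ∞ (fun x => H (w x)) := hH.comp hw
    have j1 := IsTestField.integrable_continuous_mul_divergence hHw.continuous hφ
    have j2 := IsTestField.integrable_continuous_mul_divergence (hHw.sub hw).continuous hψ
    have a1 : ∫ x, (w x)⁺ * divergence φ x ≤
        (∫ x, H (w x) * divergence φ x) + δ * ∫ x, |divergence φ x| := by
      rw [← integral_const_mul, ← integral_add j1 (iφ.const_mul δ)]
      refine integral_mono i1 (j1.add (iφ.const_mul δ)) fun x => ?_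
      have b1 := neg_le_of_abs_le ((abs_mul (H (w x) - (w x)⁺) (divergence φ x)).trans_le
        (mul_le_mul_of_nonneg_right (hc (w x)) (abs_nonneg _)))
      simp only
      linarith
    have a2 : ∫ x, (w x)⁻ * divergence ψ x ≤
        (∫ x, (H (w x) - w x) * divergence ψ x) + δ * ∫ x, |divergence ψ x| := by
      rw [← integral_const_mul, ← integral_add j2 (iψ.const_mul δ)]
      refine integral_mono i2 (j2.add (iψ.const_mul δ)) fun x => ?_
      have b1 := neg_le_of_abs_le ((abs_mul (H (w x) - (w x)⁺) (divergence ψ x)).trans_le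
        (mul_le_mul_of_nonneg_right (hc (w x)) (abs_nonneg _)))
      have b2 : (w x)⁻ = (w x)⁺ - w x := by linarith [posPart_sub_negPart (w x)]
      simp only [b2]
      linarith
    linarith
  have hlim : Tendsto
      (fun δ : ℝ => T + δ * ((∫ x, |divergence φ x|) + ∫ x, |divergence ψ x|))
      (𝓝[>] 0) (𝓝 T) := by
    refine (Continuous.tendsto' (by fun_prop) _ _ (by simp)).mono_left nhdsWithin_le_nhds
  exact ge_of_tendsto hlim (eventually_mem_nhdsWithin.mono fun δ h => hδ δ h)

/-! ### Mollification -/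

/-- The mollification of `v` by a normalized bump function. -/
noncomputable def mollify (ρ : ContDiffBump (0 : EuclideanSpace ℝ (Fin n)))
    (v : EuclideanSpace ℝ (Fin n) → ℝ) : EuclideanSpace ℝ (Fin n) → ℝ :=
  convolution (ρ.normed volume) v (ContinuousLinearMap.lsmul ℝ ℝ) volume

lemma contDiff_mollify (ρ : ContDiffBump (0 : EuclideanSpace ℝ (Fin n)))
    {v : EuclideanSpace ℝ (Fin n) → ℝ} (hv : Integrable v) : ContDiff ℝ ∞ (mollify ρ v) :=
  ρ.hasCompactSupport_normed.contDiff_convolution_left _ ρ.contDiff_normed hv.locallyIntegrable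

lemma integrable_mollify (ρ : ContDiffBump (0 : EuclideanSpace ℝ (Fin n)))
    {v : EuclideanSpace ℝ (Fin n) → ℝ} (hv : Integrable v) : Integrable (mollify ρ v) :=
  ρ.integrable_normed.integrable_convolution _ hv

lemma mollify_sub (ρ : ContDiffBump (0 : EuclideanSpace ℝ (Fin n)))
    {v g : EuclideanSpace ℝ (Fin n) → ℝ} (hv : Integrable v) (hg : Integrable g) :
    mollify ρ (fun x => v x - g x) = fun x => mollify ρ v x - mollify ρ g x := by
  have hc := fun (f : EuclideanSpace ℝ (Fin n) → ℝ) (hf : Integrable f) =>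
    (ρ.hasCompactSupport_normed (μ := volume)).convolutionExists_left
      (ContinuousLinearMap.lsmul ℝ ℝ) ρ.continuous_normed hf.locallyIntegrable
  ext x
  simp only [mollify, convolution_def]
  rw [← integral_sub (hc v hv x) (hc g hg x)]
  simp [mul_sub]

lemma integral_abs_mollify_le (ρ : ContDiffBump (0 : EuclideanSpace ℝ (Fin n)))
    {v : EuclideanSpace ℝ (Fin n) → ℝ} (hv : Integrable v) :
    ∫ x, |mollify ρ v x| ≤ ∫ x, |v x| := by
  have h : ∫ x, mollify ρ (fun x => |v x|) x = ∫ x, |v x| := by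
    unfold mollify
    rw [integral_convolution _ ρ.integrable_normed hv.abs, ρ.integral_normed]
    simp
  rw [← h]
  refine integral_mono (integrable_mollify ρ hv).abs (integrable_mollify ρ hv.abs) fun x => ?_
  simp only [mollify, convolution_def]
  refine (abs_integral_le_integral_abs).trans_eq ?_
  simp [abs_mul, abs_of_nonneg (ρ.nonneg_normed _)]

/-- Mollification averages the translates of `v`, so it does not increase the pairings with test
fields beyond their supremum. -/
lemma integral_mollify_mul_divergence_le (ρ : ContDiffBump (0 : EuclideanSpace ℝ (Fin n)))
    {v : EuclideanSpace ℝ (Fin n) → ℝ} (hv : Integrable v) {T : ℝ}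
    (hT : ∀ X : EuclideanSpace ℝ (Fin n) → EuclideanSpace ℝ (Fin n), IsTestField X →
      ∫ x, v x * divergence X x ≤ T)
    {φ : EuclideanSpace ℝ (Fin n) → EuclideanSpace ℝ (Fin n)} (hφ : IsTestField φ) :
    ∫ x, mollify ρ v x * divergence φ x ≤ T := by
  obtain ⟨C, hC⟩ := hφ.continuous_divergence.bounded_above_of_compact_support
    hφ.hasCompactSupport.divergence
  have hprod : Integrable (fun p : EuclideanSpace ℝ (Fin n) × EuclideanSpace ℝ (Fin n) =>
      (ρ.normed volume p.2 * v (p.1 - p.2)) * divergence φ p.1) (volume.prod volume) := by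
    have h := Integrable.convolution_integrand (μ := volume) (ν := volume)
      (ContinuousLinearMap.lsmul ℝ ℝ) (ρ.integrable_normed (μ := volume)) hv
    simp only [ContinuousLinearMap.lsmul_apply, smul_eq_mul] at h
    refine h.mul_bdd (c := C) ?_ (ae_of_all _ fun p => hC p.1)
    exact (hφ.continuous_divergence.comp continuous_fst).aestronglyMeasurable
  have hinner (t : EuclideanSpace ℝ (Fin n)) :
      ∫ x, (ρ.normed volume t * v (x - t)) * divergence φ x =
        ρ.normed volume t * ∫ x, v x * divergence (fun y => φ (y + t)) x := by
    simp_rw [mul_assoc]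
    rw [integral_const_mul]
    congr 1
    rw [← integral_add_right_eq_self _ t]
    simp [divergence_comp_add_right]
  calc ∫ x, mollify ρ v x * divergence φ x
      = ∫ x, ∫ t, (ρ.normed volume t * v (x - t)) * divergence φ x := by
        refine integral_congr_ae (ae_of_all _ fun x => ?_)
        simp [mollify, convolution_def, integral_mul_const]
    _ = ∫ t, ∫ x, (ρ.normed volume t * v (x - t)) * divergence φ x :=
        integral_integral_swap hprod
    _ ≤ ∫ t, ρ.normed volume t * T := by
        refine integral_mono hprod.integral_prod_right (ρ.integrable_normed.mul_const T)
          fun t => ?_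
        simp only [hinner]
        exact mul_le_mul_of_nonneg_left (hT _ (hφ.comp_add_right t)) (ρ.nonneg_normed t)
    _ = T := by rw [integral_mul_const, ρ.integral_normed, one_mul]

/-- Mollifications of an integrable function approximate it in `L¹` with a bounded weight `D`. It
is enough to compare with a continuous compactly supported function, whose mollifications converge
uniformly. -/
lemma exists_mollify_integral_abs_sub_mul_le {v : EuclideanSpace ℝ (Fin n) → ℝ}
    (hv : Integrable v) {D : EuclideanSpace ℝ (Fin n) → ℝ} (hD : Continuous D)
    (hDi : Integrable D) (hD0 : ∀ x, 0 ≤ D x) {C : ℝ} (hDC : ∀ x, D x ≤ C)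
    {η : ℝ} (hη : 0 < η) :
    ∃ ρ : ContDiffBump (0 : EuclideanSpace ℝ (Fin n)),
      ∫ x, |mollify ρ v x - v x| * D x ≤ (2 * C + ∫ x, D x) * η := by
  obtain ⟨g, hgc, hgv, hg, hgi⟩ := hv.exists_hasCompactSupport_integral_sub_le hη
  simp only [Real.norm_eq_abs] at hgv
  obtain ⟨δ, hδ, hgδ⟩ := Metric.uniformContinuous_iff.1
    (hgc.uniformContinuous_of_continuous hg) η hη
  let ρ : ContDiffBump (0 : EuclideanSpace ℝ (Fin n)) := ⟨δ / 2, δ, by positivity, by linarith⟩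
  have hunif (x : EuclideanSpace ℝ (Fin n)) : |mollify ρ g x - g x| ≤ η :=
    ρ.dist_normed_convolution_le hg.aestronglyMeasurable fun y hy => (hgδ hy).le
  have hC0 : 0 ≤ C := (hD0 0).trans (hDC 0)
  have hvg : Integrable (fun x => v x - g x) := hv.sub hgi
  have hm := integrable_mollify ρ hvg
  have hbd (f : EuclideanSpace ℝ (Fin n) → ℝ) (hf : Integrable f) :
      Integrable (fun x => |f x| * D x) :=
    hf.abs.mul_bdd (c := C) hD.aestronglyMeasurable
      (ae_of_all _ fun x => by rw [Real.norm_of_nonneg (hD0 x)]; exact hDC x)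
  refine ⟨ρ, ?_⟩
  calc ∫ x, |mollify ρ v x - v x| * D x
      ≤ ∫ x, (C * |mollify ρ (fun y => v y - g y) x| + η * D x + C * |v x - g x|) := by
        refine integral_mono (hbd _ ((integrable_mollify ρ hv).sub hv))
          (((hm.abs.const_mul C).add (hDi.const_mul η)).add (hvg.abs.const_mul C)) fun x => ?_
        have e : mollify ρ v x - v x = mollify ρ (fun y => v y - g y) x +
            (mollify ρ g x - g x) - (v x - g x) := by
          rw [mollify_sub ρ hv hgi]
          ring
        have h1 := abs_sub (mollify ρ (fun y => v y - g y) x + (mollify ρ g x - g x)) (v x - g x)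
        have h2 := abs_add_le (mollify ρ (fun y => v y - g y) x) (mollify ρ g x - g x)
        simp only [e]
        have h3 := mul_le_mul_of_nonneg_right (h1.trans (add_le_add_left h2 _)) (hD0 x)
        have h4 := mul_le_mul_of_nonneg_left (hDC x)
          (abs_nonneg (mollify ρ (fun y => v y - g y) x))
        have h5 := mul_le_mul_of_nonneg_left (hDC x) (abs_nonneg (v x - g x))
        have h6 := mul_le_mul_of_nonneg_right (hunif x) (hD0 x)
        linarith
    _ = C * (∫ x, |mollify ρ (fun y => v y - g y) x|) + η * (∫ x, D x) +
          C * ∫ x, |v x - g x| := by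
        simp only [← integral_const_mul]
        rw [← integral_add (hm.abs.const_mul C) (hDi.const_mul η),
          ← integral_add (f := fun x => C * |mollify ρ (fun y => v y - g y) x| + η * D x)
            ((hm.abs.const_mul C).add (hDi.const_mul η)) (hvg.abs.const_mul C)]
    _ ≤ C * η + η * (∫ x, D x) + C * η := by
        gcongr
        exact (integral_abs_mollify_le ρ hvg).trans hgv
    _ = (2 * C + ∫ x, D x) * η := by ring

/-! ### The total variation of the positive and negative parts -/

lemma MeasureTheory.Integrable.posPart {v : EuclideanSpace ℝ (Fin n) → ℝ} (hv : Integrable v) :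
    Integrable fun x => (v x)⁺ := hv.pos_part

lemma MeasureTheory.Integrable.negPart {v : EuclideanSpace ℝ (Fin n) → ℝ} (hv : Integrable v) :
    Integrable fun x => (v x)⁻ := hv.neg_part

/-- The positive and negative parts of an integrable function can be tested separately, at no cost
compared with testing the function itself. -/
lemma integral_posPart_add_integral_negPart_le
    {v : EuclideanSpace ℝ (Fin n) → ℝ} (hv : Integrable v) {T : ℝ}
    (hT : ∀ X : EuclideanSpace ℝ (Fin n) → EuclideanSpace ℝ (Fin n), IsTestField X →
      ∫ x, v x * divergence X x ≤ T)
    {φ ψ : EuclideanSpace ℝ (Fin n) → EuclideanSpace ℝ (Fin n)}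
    (hφ : IsTestField φ) (hψ : IsTestField ψ) :
    (∫ x, (v x)⁺ * divergence φ x) + ∫ x, (v x)⁻ * divergence ψ x ≤ T := by
  let D : EuclideanSpace ℝ (Fin n) → ℝ := fun x => |divergence φ x| + |divergence ψ x|
  have hD : Continuous D := hφ.continuous_divergence.abs.add hψ.continuous_divergence.abs
  have hDi : Integrable D :=
    (hφ.continuous_divergence.integrable_of_hasCompactSupport
      hφ.hasCompactSupport.divergence).abs.add
    (hψ.continuous_divergence.integrable_of_hasCompactSupport
      hψ.hasCompactSupport.divergence).abs
  have hD0 (x : EuclideanSpace ℝ (Fin n)) : 0 ≤ D x := by positivity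
  obtain ⟨C₁, hC₁⟩ := hφ.continuous_divergence.bounded_above_of_compact_support
    hφ.hasCompactSupport.divergence
  obtain ⟨C₂, hC₂⟩ := hψ.continuous_divergence.bounded_above_of_compact_support
    hψ.hasCompactSupport.divergence
  have hDC (x : EuclideanSpace ℝ (Fin n)) : D x ≤ C₁ + C₂ := add_le_add (hC₁ x) (hC₂ x)
  have hη (η : ℝ) (hη : 0 < η) :
      (∫ x, (v x)⁺ * divergence φ x) + ∫ x, (v x)⁻ * divergence ψ x ≤
        T + (2 * (C₁ + C₂) + ∫ x, D x) * η := by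
    obtain ⟨ρ, hρ⟩ := exists_mollify_integral_abs_sub_mul_le hv hD hDi hD0 hDC hη
    have hwi := integrable_mollify ρ hv
    have key := integral_posPart_add_integral_negPart_le_of_contDiff (contDiff_mollify ρ hv)
      (fun X hX => integral_mollify_mul_divergence_le ρ hv hT hX) hφ hψ
    have i1 := hφ.integrable_mul_divergence hv.posPart
    have i2 := hψ.integrable_mul_divergence hv.negPart
    have j1 := hφ.integrable_mul_divergence hwi.posPart
    have j2 := hψ.integrable_mul_divergence hwi.negPart
    have hdiff : Integrable (fun x => |mollify ρ v x - v x| * D x) :=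
      (hwi.sub hv).abs.mul_bdd (c := C₁ + C₂) hD.aestronglyMeasurable
        (ae_of_all _ fun x => by rw [Real.norm_of_nonneg (hD0 x)]; exact hDC x)
    rw [← integral_add i1 i2]
    rw [← integral_add j1 j2] at key
    have hle : ∫ x, ((v x)⁺ * divergence φ x + (v x)⁻ * divergence ψ x) ≤
        ∫ x, (((mollify ρ v x)⁺ * divergence φ x + (mollify ρ v x)⁻ * divergence ψ x) +
          |mollify ρ v x - v x| * D x) := by
      refine integral_mono (i1.add i2) ((j1.add j2).add hdiff) fun x => ?_
      have h1 : |(v x)⁺ - (mollify ρ v x)⁺| ≤ |mollify ρ v x - v x| := by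
        rw [abs_sub_comm]
        exact abs_max_sub_max_le_abs _ _ _
      have h2 : |(v x)⁻ - (mollify ρ v x)⁻| ≤ |mollify ρ v x - v x| :=
        (abs_max_sub_max_le_abs _ _ _).trans_eq (by congr 1; ring)
      have h3 := (le_abs_self _).trans ((abs_mul _ (divergence φ x)).trans_le
        (mul_le_mul_of_nonneg_right h1 (abs_nonneg _)))
      have h4 := (le_abs_self _).trans ((abs_mul _ (divergence ψ x)).trans_le
        (mul_le_mul_of_nonneg_right h2 (abs_nonneg _)))
      simp only [D]
      linarith
    have hadd := integral_add
      (f := fun x => (mollify ρ v x)⁺ * divergence φ x + (mollify ρ v x)⁻ * divergence ψ x)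
      (j1.add j2) hdiff
    linarith
  have hlim : Tendsto (fun η : ℝ => T + (2 * (C₁ + C₂) + ∫ x, D x) * η) (𝓝[>] 0) (𝓝 T) :=
    (Continuous.tendsto' (by fun_prop) _ _ (by simp)).mono_left nhdsWithin_le_nhds
  exact ge_of_tendsto hlim (eventually_mem_nhdsWithin.mono fun η h => hη η h)

/-- Splitting a function into its positive and negative parts neither creates nor destroys total
variation. -/
lemma totalVariation_posPart_add_negPart {v : EuclideanSpace ℝ (Fin n) → ℝ}
    (hv : Integrable v) :
    totalVariation (fun x => (v x)⁺) + totalVariation (fun x => (v x)⁻) = totalVariation v := by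
  apply le_antisymm
  · rcases eq_or_ne (totalVariation v) ⊤ with htop | htop
    · rw [htop]
      exact le_top
    rw [← ENNReal.ofReal_toReal htop]
    refine totalVariation_add_le_of_forall fun φ ψ hφ hψ =>
      integral_posPart_add_integral_negPart_le hv (fun X hX => ?_) hφ hψ
    exact (ENNReal.ofReal_le_iff_le_toReal htop).1 (hX.ofReal_integral_le_totalVariation v)
  · simpa using totalVariation_sub_le hv.posPart hv.negPart

/-! ### Passing between the two problems -/

lemma mem_skeleton_two_iff {y : EuclideanSpace ℝ (Fin 2)} :
    y ∈ skeleton 2 ↔ 0 ≤ y 0 ∧ 0 ≤ y 1 ∧ (y 0 = 0 ∨ y 1 = 0) := by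
  simp only [skeleton, Set.mem_iUnion, Set.mem_ofPred_eq, Fin.exists_fin_two]
  constructor
  · rintro (⟨t, ht, rfl⟩ | ⟨t, ht, rfl⟩) <;> simp [ht]
  · rintro ⟨h0, h1, h | h⟩
    · refine .inr ⟨y 1, h1, ?_⟩
      ext i
      fin_cases i <;> simp [h]
    · refine .inl ⟨y 0, h0, ?_⟩
      ext i
      fin_cases i <;> simp [h]

lemma clusterEnergy_two (u : EuclideanSpace ℝ (Fin n) → EuclideanSpace ℝ (Fin 2)) :
    clusterEnergy u = totalVariation (fun x => u x 0) + totalVariation (fun x => u x 1) :=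
  Fin.sum_univ_two _

/-- The components of a function with values in the skeleton are the positive and negative parts of
their difference. -/
lemma MemBVSkeleton.posPart_negPart_ae_eq {Ω : Set (EuclideanSpace ℝ (Fin n))}
    (hΩ : MeasurableSet Ω) {u : EuclideanSpace ℝ (Fin n) → EuclideanSpace ℝ (Fin 2)}
    (hu : MemBVSkeleton 2 Ω u) :
    (fun x => (u x 0 - u x 1)⁺) =ᵐ[volume] (fun x => u x 0) ∧
      (fun x => (u x 0 - u x 1)⁻) =ᵐ[volume] (fun x => u x 1) := by
  have h : ∀ᵐ x, 0 ≤ u x 0 ∧ 0 ≤ u x 1 ∧ (u x 0 = 0 ∨ u x 1 = 0) := by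
    filter_upwards [(ae_restrict_iff' hΩ).1 hu.ae_mem, (hu.memBV 0).ae_eq_zero,
      (hu.memBV 1).ae_eq_zero] with x hx h0 h1
    by_cases hxΩ : x ∈ Ω
    · exact mem_skeleton_two_iff.1 (hx hxΩ)
    · simp [h0 hxΩ, h1 hxΩ]
  constructor <;> filter_upwards [h] with x hx <;> obtain ⟨h0, h1, h | h⟩ := hx <;>
    simp [h, h0, h1]

lemma sub_mem_signedAdmissible {Ω : Set (EuclideanSpace ℝ (Fin n))} (hΩ : MeasurableSet Ω)
    {u : EuclideanSpace ℝ (Fin n) → EuclideanSpace ℝ (Fin 2)}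
    (hu : u ∈ clusterAdmissible 2 Ω) : (fun x => u x 0 - u x 1) ∈ signedAdmissible Ω := by
  obtain ⟨hu, hnorm⟩ := hu
  obtain ⟨hp, hn⟩ := hu.posPart_negPart_ae_eq hΩ
  refine ⟨⟨(hu.memBV 0).integrable.sub (hu.memBV 1).integrable, ?_, ?_⟩, ?_, ?_⟩
  · exact (totalVariation_sub_le (hu.memBV 0).integrable (hu.memBV 1).integrable).trans_lt
      (ENNReal.add_lt_top.2 ⟨(hu.memBV 0).totalVariation_lt_top,
        (hu.memBV 1).totalVariation_lt_top⟩)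
  · filter_upwards [(hu.memBV 0).ae_eq_zero, (hu.memBV 1).ae_eq_zero] with x h0 h1 hx
    simp [h0 hx, h1 hx]
  · rw [eLpNorm_congr_ae (ae_restrict_of_ae hp), hnorm]
  · rw [eLpNorm_congr_ae (ae_restrict_of_ae hn), hnorm]

lemma totalVariation_sub_eq_clusterEnergy {Ω : Set (EuclideanSpace ℝ (Fin n))}
    (hΩ : MeasurableSet Ω) {u : EuclideanSpace ℝ (Fin n) → EuclideanSpace ℝ (Fin 2)}
    (hu : MemBVSkeleton 2 Ω u) : totalVariation (fun x => u x 0 - u x 1) = clusterEnergy u := by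
  obtain ⟨hp, hn⟩ := hu.posPart_negPart_ae_eq hΩ
  rw [clusterEnergy_two, ← totalVariation_congr_ae hp, ← totalVariation_congr_ae hn]
  exact (totalVariation_posPart_add_negPart
    ((hu.memBV 0).integrable.sub (hu.memBV 1).integrable)).symm

lemma clusterEnergy_posPart_negPart {v : EuclideanSpace ℝ (Fin n) → ℝ} (hv : Integrable v) :
    clusterEnergy (fun x => !₂[(v x)⁺, (v x)⁻]) = totalVariation v := by
  rw [clusterEnergy_two]
  exact totalVariation_posPart_add_negPart hv

lemma posPart_negPart_mem_clusterAdmissible {Ω : Set (EuclideanSpace ℝ (Fin n))}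
    {v : EuclideanSpace ℝ (Fin n) → ℝ} (hv : v ∈ signedAdmissible Ω) :
    (fun x => !₂[(v x)⁺, (v x)⁻]) ∈ clusterAdmissible 2 Ω := by
  obtain ⟨hv, hp, hn⟩ := hv
  have hTV := totalVariation_posPart_add_negPart hv.integrable
  have hlt := hTV.trans_lt hv.totalVariation_lt_top
  refine ⟨⟨Fin.forall_fin_two.2 ⟨⟨hv.integrable.posPart, (ENNReal.add_lt_top.1 hlt).1, ?_⟩,
    ⟨hv.integrable.negPart, (ENNReal.add_lt_top.1 hlt).2, ?_⟩⟩, ae_of_all _ fun x => ?_⟩,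
    Fin.forall_fin_two.2 ⟨hp, hn⟩⟩
  · filter_upwards [hv.ae_eq_zero] with x h hx
    simp [h hx]
  · filter_upwards [hv.ae_eq_zero] with x h hx
    simp [h hx]
  · rw [mem_skeleton_two_iff]
    refine ⟨posPart_nonneg _, negPart_nonneg _, ?_⟩
    rcases le_total (v x) 0 with h | h
    · exact .inl (posPart_of_nonpos h)
    · exact .inr (negPart_of_nonneg h)

end

theorem proposition4p1 (n : ℕ) (Ω : Set (EuclideanSpace ℝ (Fin n)))
    (hΩ_nonempty : Ω.Nonempty) (hΩ_open : IsOpen Ω) (hΩ_bounded : Bornology.IsBounded Ω) :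
    clusterInf 2 Ω = signedInf Ω ∧
    (∀ u : EuclideanSpace ℝ (Fin n) → EuclideanSpace ℝ (Fin 2),
      IsClusterMinimizer 2 Ω u → IsSignedMinimizer Ω (fun x => u x 0 - u x 1)) ∧
    (∀ v : EuclideanSpace ℝ (Fin n) → ℝ,
      IsSignedMinimizer Ω v → IsClusterMinimizer 2 Ω (fun x => !₂[(v x)⁺, (v x)⁻])) := by
  have hΩ := hΩ_open.measurableSet
  have hinf : clusterInf 2 Ω = signedInf Ω := by
    apply le_antisymm
    · refine le_iInf₂ fun v hv => ?_
      rw [← clusterEnergy_posPart_negPart hv.1.integrable]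
      exact iInf₂_le _ (posPart_negPart_mem_clusterAdmissible hv)
    · refine le_iInf₂ fun u hu => ?_
      rw [← totalVariation_sub_eq_clusterEnergy hΩ hu.1]
      exact iInf₂_le _ (sub_mem_signedAdmissible hΩ hu)
  refine ⟨hinf, fun u ⟨hu, hmin⟩ => ⟨sub_mem_signedAdmissible hΩ hu, ?_⟩,
    fun v ⟨hv, hmin⟩ => ⟨posPart_negPart_mem_clusterAdmissible hv, ?_⟩⟩
  · rw [totalVariation_sub_eq_clusterEnergy hΩ hu.1, hmin, hinf]
  · rw [clusterEnergy_posPart_negPart hv.1.integrable, hmin, hinf]
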